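/- Let $\mathrm{CLKID}^{\omega}$ be the cyclic proof system of Brotherston and Simpson for classical first-order logic with equality and inductive definitions: sequents $\Gamma\vdash\Delta$ are pairs of finite sets of first-order formulas; the rules are axiom, weakening, cut, substitution, the usual left and right rules for $\neg,\wedge,\vee,\to,\forall,\exists,=$, and, for every inductive predicate, the right unfolding rules and the left case-split rule given by its productions; a proof is a finite derivation tree in which every bud (open leaf) is assigned a companion, i.e. an inner node with the same sequent, such that the tree-unfolding satisfies the global trace condition (some tail of every infinite path is followed by a trace with infinitely many progress points). A proof is cut-free if it does not contain the cut rule. Cut cannot be eliminated in $\mathrm{CLKID}^{\omega}$, even if all predicate symbols of the language (other than $=$) are unary and its function symbols are only constants and one unary function symbol: it is not the case that, for every such language and every inductive definition set over it, each sequent provable in $\mathrm{CLKID}^{\omega}$ is cut-free provable in $\mathrm{CLKID}^{\omega}$. In fact, in the language with two constants $s,e$, one unary function symbol $n$ and two unary inductive predicates $\mathrm{ToE}$, $\mathrm{FromS}$ with the productions $$\frac{}{\mathrm{ToE}(e)}\qquad \frac{\mathrm{ToE}(n x)}{\mathrm{ToE}(x)}\qquad \frac{}{\mathrm{FromS}(s)}\qquad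 \frac{\mathrm{FromS}(x)}{\mathrm{FromS}(n x)},$$ the sequent $\mathrm{ToE}(s)\vdash \mathrm{FromS}(e)$ is provable in $\mathrm{CLKID}^{\omega}$ but not cut-free provable in $\mathrm{CLKID}^{\omega}$. -/

import Mathlib

/-! # The cyclic proof system `CLKID^ω` for classical first-order logic with inductive definitions

Terms are Mathlib's `L.Term ℕ` (the variables are the natural numbers).  Formulas are first-order
formulas over `L` with equality and all connectives and quantifiers as primitives; bound variables
are treated in the de Bruijn way, so that formulas are identified up to renaming of bound variables
and substitution never captures a variable. -/

namespace CLKID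

variable {L : FirstOrder.Language.{0, 0}}

/-! ## Syntax -/

/-- Atomic formulas `R(t₁, …, tₙ)` with an `n`-ary predicate symbol `R`. -/
structure Atom (L : FirstOrder.Language.{0, 0}) where
  {arity : ℕ}
  rel : L.Relations arity
  args : Fin arity → L.Term ℕ

/-- First-order formulas.  In `all φ` and `ex φ` the quantifier binds the variable `0` of `φ`, and
the variable `k + 1` of `φ` stands for the variable `k` of `all φ`, `ex φ`. -/
inductive Fml (L : FirstOrder.Language.{0, 0}) : Type
  | eq (t u : L.Term ℕ) : Fml L
  | atom (A : Atom L) : Fml L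
  | neg (φ : Fml L) : Fml L
  | and (φ ψ : Fml L) : Fml L
  | or (φ ψ : Fml L) : Fml L
  | imp (φ ψ : Fml L) : Fml L
  | all (φ : Fml L) : Fml L
  | ex (φ : Fml L) : Fml L

noncomputable instance : DecidableEq (Fml L) := Classical.decEq _

/-- Simultaneous substitution in an atomic formula. -/
def Atom.subst (A : Atom L) (θ : ℕ → L.Term ℕ) : Atom L :=
  ⟨A.rel, fun i => (A.args i).subst θ⟩

/-- The variables that occur in an atomic formula. -/
def Atom.fv (A : Atom L) : Set ℕ := {x | ∃ i, x ∈ (A.args i).varFinset}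

/-- The substitution `θ` carried below a quantifier. -/
def liftSubst (θ : ℕ → L.Term ℕ) : ℕ → L.Term ℕ
  | 0 => FirstOrder.Language.Term.var 0
  | k + 1 => (θ k).relabel Nat.succ

/-- The formula `φ[θ]`: simultaneous capture-avoiding substitution. -/
def Fml.subst : Fml L → (ℕ → L.Term ℕ) → Fml L
  | .eq t u, θ => .eq (t.subst θ) (u.subst θ)
  | .atom A, θ => .atom (A.subst θ)
  | .neg φ, θ => .neg (φ.subst θ)
  | .and φ ψ, θ => .and (φ.subst θ) (ψ.subst θ)
  | .or φ ψ, θ => .or (φ.subst θ) (ψ.subst θ)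
  | .imp φ ψ, θ => .imp (φ.subst θ) (ψ.subst θ)
  | .all φ, θ => .all (φ.subst (liftSubst θ))
  | .ex φ, θ => .ex (φ.subst (liftSubst θ))

/-- The free variables of a formula. -/
def Fml.fv : Fml L → Set ℕ
  | .eq t u => {x | x ∈ t.varFinset ∨ x ∈ u.varFinset}
  | .atom A => A.fv
  | .neg φ => φ.fv
  | .and φ ψ => φ.fv ∪ ψ.fv
  | .or φ ψ => φ.fv ∪ ψ.fv
  | .imp φ ψ => φ.fv ∪ ψ.fv
  | .all φ => {x | x + 1 ∈ φ.fv}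
  | .ex φ => {x | x + 1 ∈ φ.fv}

/-- The instance of the body `φ` of a quantified formula at the term `t`. -/
def Fml.inst (φ : Fml L) (t : L.Term ℕ) : Fml L :=
  φ.subst fun
    | 0 => t
    | k + 1 => FirstOrder.Language.Term.var k

/-- The substitution `[x := t, y := u]`. -/
def subst₂ (x : ℕ) (t : L.Term ℕ) (y : ℕ) (u : L.Term ℕ) : ℕ → L.Term ℕ := fun z =>
  if z = x then t else if z = y then u else FirstOrder.Language.Term.var z

/-- Sequents `Γ ⊢ Δ` of finite sets of formulas. -/
@[ext] structure Sequent (L : FirstOrder.Language.{0, 0}) where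
  ant : Finset (Fml L)
  suc : Finset (Fml L)

/-- `Γ[θ] = {φ[θ] | φ ∈ Γ}`. -/
noncomputable def substSet (Γ : Finset (Fml L)) (θ : ℕ → L.Term ℕ) : Finset (Fml L) :=
  Γ.image fun φ => φ.subst θ

/-- The free variables of a finite set of formulas. -/
def fvSet (Γ : Finset (Fml L)) : Set ℕ := {x | ∃ φ ∈ Γ, x ∈ φ.fv}

/-! ## Inductive definitions -/

/-- A production with a conclusion `P(args)`, for a given `n`-ary predicate symbol `P`; the
assumptions are atomic formulas. -/
structure Production (L : FirstOrder.Language.{0, 0}) (n : ℕ) where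
  assumptions : List (Atom L)
  args : Fin n → L.Term ℕ

/-- The variables of a production. -/
def Production.vars {n : ℕ} (p : Production L n) : Set ℕ :=
  {x | (∃ A ∈ p.assumptions, x ∈ A.fv) ∨ ∃ i, x ∈ (p.args i).varFinset}

/-- A division of the predicate symbols of `L` into finitely many inductive ones and the remaining
(ordinary) ones, with an inductive definition set: a finite set of productions for the inductive
predicate symbols.  The productions for `P` are given in some order, `prods P`. -/
structure IndDefSet (L : FirstOrder.Language.{0, 0}) where
  IsInd : ∀ {n : ℕ}, L.Relations n → Prop
  finite_ind : {P : Σ n, L.Relations n | IsInd P.2}.Finite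
  prods : ∀ {n : ℕ}, L.Relations n → List (Production L n)
  prods_ordinary : ∀ {n : ℕ} (R : L.Relations n), ¬ IsInd R → prods R = []

/-- The case distinction of `Γ, P(u) ⊢ Δ` for a production `p` for `P`, with the variables of `p`
renamed by `ρ`. -/
noncomputable def caseDistinction (Γ Δ : Finset (Fml L)) {n : ℕ} (u : Fin n → L.Term ℕ)
    (p : Production L n) (ρ : ℕ → ℕ) : Sequent L where
  ant := Γ ∪ Finset.univ.image (fun i => Fml.eq (u i) ((p.args i).relabel ρ)) ∪
    (p.assumptions.map fun A => Fml.atom (A.subst fun x => FirstOrder.Language.Term.var (ρ x))).toFinset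
  suc := Δ

/-! ## Inference rules -/

/-- Instances of the inference rules, with all their parameters. -/
inductive Rule (L : FirstOrder.Language.{0, 0}) : Type
  | ax (Γ Δ : Finset (Fml L))
  | weak (Γ' Δ' Γ Δ : Finset (Fml L))
  | cut (Γ Δ : Finset (Fml L)) (φ : Fml L)
  | subst (Γ Δ : Finset (Fml L)) (θ : ℕ → L.Term ℕ)
  | negL (Γ Δ : Finset (Fml L)) (φ : Fml L)
  | negR (Γ Δ : Finset (Fml L)) (φ : Fml L)
  | andL (Γ Δ : Finset (Fml L)) (φ ψ : Fml L)
  | andR (Γ Δ : Finset (Fml L)) (φ ψ : Fml L)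
  | orL (Γ Δ : Finset (Fml L)) (φ ψ : Fml L)
  | orR (Γ Δ : Finset (Fml L)) (φ ψ : Fml L)
  | impL (Γ Δ : Finset (Fml L)) (φ ψ : Fml L)
  | impR (Γ Δ : Finset (Fml L)) (φ ψ : Fml L)
  | allL (Γ Δ : Finset (Fml L)) (φ : Fml L) (t : L.Term ℕ)
  | allR (Γ Δ : Finset (Fml L)) (φ : Fml L) (x : ℕ)
  | exL (Γ Δ : Finset (Fml L)) (φ : Fml L) (x : ℕ)
  | exR (Γ Δ : Finset (Fml L)) (φ : Fml L) (t : L.Term ℕ)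
  | eqL (Γ Δ : Finset (Fml L)) (x y : ℕ) (t u : L.Term ℕ)
  | eqR (Γ Δ : Finset (Fml L)) (t : L.Term ℕ)
  | indR (Γ Δ : Finset (Fml L)) {n : ℕ} (P : L.Relations n) (p : Production L n)
      (θ : ℕ → L.Term ℕ)
  | case (Γ Δ : Finset (Fml L)) {n : ℕ} (P : L.Relations n) (u : Fin n → L.Term ℕ)
      (ρ : Production L n → ℕ → ℕ)

/-- The conclusion of a rule instance. -/
noncomputable def Rule.concl : Rule L → Sequent L
  | ax Γ Δ => ⟨Γ, Δ⟩
  | weak _ _ Γ Δ => ⟨Γ, Δ⟩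
  | cut Γ Δ _ => ⟨Γ, Δ⟩
  | subst Γ Δ θ => ⟨substSet Γ θ, substSet Δ θ⟩
  | negL Γ Δ φ => ⟨insert (.neg φ) Γ, Δ⟩
  | negR Γ Δ φ => ⟨Γ, insert (.neg φ) Δ⟩
  | andL Γ Δ φ ψ => ⟨insert (.and φ ψ) Γ, Δ⟩
  | andR Γ Δ φ ψ => ⟨Γ, insert (.and φ ψ) Δ⟩
  | orL Γ Δ φ ψ => ⟨insert (.or φ ψ) Γ, Δ⟩
  | orR Γ Δ φ ψ => ⟨Γ, insert (.or φ ψ) Δ⟩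
  | impL Γ Δ φ ψ => ⟨insert (.imp φ ψ) Γ, Δ⟩
  | impR Γ Δ φ ψ => ⟨Γ, insert (.imp φ ψ) Δ⟩
  | allL Γ Δ φ _ => ⟨insert (.all φ) Γ, Δ⟩
  | allR Γ Δ φ _ => ⟨Γ, insert (.all φ) Δ⟩
  | exL Γ Δ φ _ => ⟨insert (.ex φ) Γ, Δ⟩
  | exR Γ Δ φ _ => ⟨Γ, insert (.ex φ) Δ⟩
  | eqL Γ Δ x y t u =>
      ⟨insert (.eq t u) (substSet Γ (subst₂ x t y u)), substSet Δ (subst₂ x t y u)⟩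
  | eqR Γ Δ t => ⟨Γ, insert (.eq t t) Δ⟩
  | indR Γ Δ P p θ => ⟨Γ, insert (.atom ⟨P, fun i => (p.args i).subst θ⟩) Δ⟩
  | case Γ Δ P u _ => ⟨insert (.atom ⟨P, u⟩) Γ, Δ⟩

/-- The assumptions of a rule instance, from left to right. -/
noncomputable def Rule.prems (Φ : IndDefSet L) : Rule L → List (Sequent L)
  | ax _ _ => []
  | weak Γ' Δ' _ _ => [⟨Γ', Δ'⟩]
  | cut Γ Δ φ => [⟨Γ, insert φ Δ⟩, ⟨insert φ Γ, Δ⟩]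
  | subst Γ Δ _ => [⟨Γ, Δ⟩]
  | negL Γ Δ φ => [⟨Γ, insert φ Δ⟩]
  | negR Γ Δ φ => [⟨insert φ Γ, Δ⟩]
  | andL Γ Δ φ ψ => [⟨insert φ (insert ψ Γ), Δ⟩]
  | andR Γ Δ φ ψ => [⟨Γ, insert φ Δ⟩, ⟨Γ, insert ψ Δ⟩]
  | orL Γ Δ φ ψ => [⟨insert φ Γ, Δ⟩, ⟨insert ψ Γ, Δ⟩]
  | orR Γ Δ φ ψ => [⟨Γ, insert φ (insert ψ Δ)⟩]
  | impL Γ Δ φ ψ => [⟨Γ, insert φ Δ⟩, ⟨insert ψ Γ, Δ⟩]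
  | impR Γ Δ φ ψ => [⟨insert φ Γ, insert ψ Δ⟩]
  | allL Γ Δ φ t => [⟨insert (φ.inst t) Γ, Δ⟩]
  | allR Γ Δ φ x => [⟨Γ, insert (φ.inst (.var x)) Δ⟩]
  | exL Γ Δ φ x => [⟨insert (φ.inst (.var x)) Γ, Δ⟩]
  | exR Γ Δ φ t => [⟨Γ, insert (φ.inst t) Δ⟩]
  | eqL Γ Δ x y t u => [⟨substSet Γ (subst₂ x u y t), substSet Δ (subst₂ x u y t)⟩]
  | eqR _ _ _ => []
  | indR Γ Δ _ p θ => p.assumptions.map fun A => ⟨Γ, insert (.atom (A.subst θ)) Δ⟩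
  | case Γ Δ P u ρ => (Φ.prods P).map fun p => caseDistinction Γ Δ u p (ρ p)

/-- The side conditions of the rules. -/
def Rule.SideCondition (Φ : IndDefSet L) : Rule L → Prop
  | ax Γ Δ => (Γ ∩ Δ).Nonempty
  | weak Γ' Δ' Γ Δ => Γ' ⊆ Γ ∧ Δ' ⊆ Δ
  | allR Γ Δ φ x => x ∉ fvSet Γ ∧ x ∉ fvSet Δ ∧ x ∉ (Fml.all φ).fv
  | exL Γ Δ φ x => x ∉ fvSet Γ ∧ x ∉ fvSet Δ ∧ x ∉ (Fml.ex φ).fv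
  | eqL _ _ x y _ _ => x ≠ y
  | indR _ _ P p _ => Φ.IsInd P ∧ p ∈ Φ.prods P
  | case Γ Δ P u ρ => Φ.IsInd P ∧ ∀ p ∈ Φ.prods P, Set.InjOn (ρ p) p.vars ∧
      ∀ x ∈ p.vars, ρ p x ∉ fvSet Γ ∧ ρ p x ∉ fvSet Δ ∧ ρ p x ∉ (Atom.mk P u).fv
  | _ => True

/-- The rule is the cut rule. -/
def Rule.IsCut : Rule L → Prop
  | cut _ _ _ => True
  | _ => False

/-! ## Derivation trees -/

/-- Partial functions from finite sequences of natural numbers to pairs of a sequent and a label,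
which is `some r` for an application of the rule instance `r`, and `none` for a bud. -/
abbrev Tree (L : FirstOrder.Language.{0, 0}) := List ℕ → Option (Sequent L × Option (Rule L))

/-- `T` is a (possibly infinite) derivation tree. -/
structure Tree.IsDerivation (Φ : IndDefSet L) (T : Tree L) : Prop where
  root : T [] ≠ none
  prefix_closed : ∀ σ n, T σ = none → T (σ ++ [n]) = none
  bud : ∀ σ S n, T σ = some (S, none) → T (σ ++ [n]) = none
  rule : ∀ σ S r, T σ = some (S, some r) → r.SideCondition Φ ∧ r.concl = S ∧
    ∀ n, (T (σ ++ [n])).map Prod.fst = (r.prems Φ)[n]?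

/-- `p` is an infinite path in `T`. -/
def Tree.IsPath (T : Tree L) (p : ℕ → List ℕ) : Prop :=
  (∀ i, T (p i) ≠ none) ∧ ∀ i, ∃ n, p (i + 1) = p i ++ [n]

/-- `B` is a case-descendant of the principal formula of the instance `r` of a case rule, in the
assumption number `n` of `r`. -/
def Rule.CaseDescendant (Φ : IndDefSet L) (r : Rule L) (n : ℕ) (A B : Atom L) : Prop :=
  match r with
  | case _ _ P u ρ => A = ⟨P, u⟩ ∧ ∃ p, (Φ.prods P)[n]? = some p ∧
      ∃ C ∈ p.assumptions, Φ.IsInd C.rel ∧ B = C.subst fun x => FirstOrder.Language.Term.var (ρ p x)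
  | _ => False

/-- `A`, `B` may be consecutive members of a trace that goes from the conclusion of the rule
instance `r` to its assumption number `n`. -/
def Rule.TraceStep (Φ : IndDefSet L) (r : Rule L) (n : ℕ) (A B : Atom L) : Prop :=
  match r with
  | subst _ _ θ => A = B.subst θ
  | eqL _ _ _ _ t u => ∃ (C : Atom L) (x y : ℕ), x ≠ y ∧
      A = C.subst (subst₂ x t y u) ∧ B = C.subst (subst₂ x u y t)
  | case Γ Δ P u ρ => (Rule.case Γ Δ P u ρ).CaseDescendant Φ n A B ∨ B = A
  | _ => B = A

/-- `τ` is a trace following the infinite path `p` in `T`. -/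
def Tree.IsTrace (Φ : IndDefSet L) (T : Tree L) (p : ℕ → List ℕ) (τ : ℕ → Atom L) : Prop :=
  (∀ i, Φ.IsInd (τ i).rel ∧ ∀ S l, T (p i) = some (S, l) → Fml.atom (τ i) ∈ S.ant) ∧
  ∀ i S r n, T (p i) = some (S, some r) → p (i + 1) = p i ++ [n] →
    r.TraceStep Φ n (τ i) (τ (i + 1))

/-- `i` is a progress point of the trace `τ` following the path `p` in `T`. -/
def Tree.IsProgress (Φ : IndDefSet L) (T : Tree L) (p : ℕ → List ℕ) (τ : ℕ → Atom L)
    (i : ℕ) : Prop :=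
  ∃ S r n, T (p i) = some (S, some r) ∧ p (i + 1) = p i ++ [n] ∧
    r.CaseDescendant Φ n (τ i) (τ (i + 1))

/-- The global trace condition: some tail of every infinite path is followed by a trace with
infinitely many progress points. -/
def Tree.GlobalTrace (Φ : IndDefSet L) (T : Tree L) : Prop :=
  ∀ p, T.IsPath p → ∃ k τ, T.IsTrace Φ (fun i => p (k + i)) τ ∧
    {i | T.IsProgress Φ (fun i => p (k + i)) τ i}.Infinite

/-! ## Cyclic proofs -/

/-- `σ` is a bud of `T`. -/
def Tree.IsBud (T : Tree L) (σ : List ℕ) : Prop := ∃ S, T σ = some (S, none)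

/-- Pre-proofs of `CLKID^ω`: a finite derivation tree with a function that maps each bud to a
companion, which is an inner node with the same sequent. -/
structure PreProof (Φ : IndDefSet L) where
  tree : Tree L
  isDerivation : tree.IsDerivation Φ
  finite : {σ | tree σ ≠ none}.Finite
  companion : List ℕ → List ℕ
  companion_spec : ∀ σ S, tree σ = some (S, none) → ∃ r, tree (companion σ) = some (S, some r)

open Classical in
/-- A node, or its companion if it is a bud. -/
noncomputable def PreProof.resolve {Φ : IndDefSet L} (π : PreProof Φ) (σ : List ℕ) : List ℕ :=
  if π.tree.IsBud σ then π.companion σ else σ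

/-- The node of the finite tree that is reached from the node `ν` by the branch `σ`, passing from
each bud on the way to its companion. -/
noncomputable def PreProof.follow {Φ : IndDefSet L} (π : PreProof Φ) (ν σ : List ℕ) : List ℕ :=
  σ.foldl (fun μ n => π.resolve (μ ++ [n])) (π.resolve ν)

/-- The tree-unfolding of a pre-proof. -/
noncomputable def PreProof.unfolding {Φ : IndDefSet L} (π : PreProof Φ) : Tree L :=
  fun σ => π.tree (π.follow [] σ)

/-- `π` is a pre-proof of the sequent `S`. -/
def PreProof.Concludes {Φ : IndDefSet L} (π : PreProof Φ) (S : Sequent L) : Prop :=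
  ∃ l, π.tree [] = some (S, l)

/-- `π` is a proof: its tree-unfolding satisfies the global trace condition. -/
def PreProof.IsProof {Φ : IndDefSet L} (π : PreProof Φ) : Prop := π.unfolding.GlobalTrace Φ

/-- `π` does not contain the cut rule. -/
def PreProof.CutFree {Φ : IndDefSet L} (π : PreProof Φ) : Prop :=
  ∀ σ S r, π.tree σ = some (S, some r) → ¬ r.IsCut

/-- `S` is provable in `CLKID^ω`. -/
def Provable (Φ : IndDefSet L) (S : Sequent L) : Prop :=
  ∃ π : PreProof Φ, π.Concludes S ∧ π.IsProof

/-- `S` is cut-free provable in `CLKID^ω`. -/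
def CutFreeProvable (Φ : IndDefSet L) (S : Sequent L) : Prop :=
  ∃ π : PreProof Φ, π.Concludes S ∧ π.IsProof ∧ π.CutFree

/-- Cut can be eliminated in `CLKID^ω` over the language `L` with the inductive definitions `Φ`. -/
def CutElimination (Φ : IndDefSet L) : Prop := ∀ S : Sequent L, Provable Φ S → CutFreeProvable Φ S

/-- All predicate symbols of `L` are unary. -/
def UnaryPredicates (L : FirstOrder.Language.{0, 0}) : Prop := ∀ n, Nonempty (L.Relations n) → n = 1

/-- The function symbols of `L` are constants and one unary function symbol. -/
def ConstantsAndOneUnary (L : FirstOrder.Language.{0, 0}) : Prop :=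
  (∀ n, Nonempty (L.Functions n) → n ≤ 1) ∧ Nonempty (Unique (L.Functions 1))

/-! ## Two unary inductive predicates -/

/-- Two constants and a unary function symbol. -/
inductive PathFunc : ℕ → Type
  | start : PathFunc 0
  | goal : PathFunc 0
  | next : PathFunc 1

/-- Two unary predicate symbols. -/
inductive PathRel : ℕ → Type
  | toGoal : PathRel 1
  | fromStart : PathRel 1

/-- The language of the two predicates. -/
abbrev pathLang : FirstOrder.Language.{0, 0} := ⟨PathFunc, PathRel⟩

/-- The constant `s`. -/
def startTerm : pathLang.Term ℕ := FirstOrder.Language.Term.func (L := pathLang) PathFunc.start ![]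

/-- The constant `e`. -/
def goalTerm : pathLang.Term ℕ := FirstOrder.Language.Term.func (L := pathLang) PathFunc.goal ![]

/-- The term `n t`. -/
def nextTerm (t : pathLang.Term ℕ) : pathLang.Term ℕ :=
  FirstOrder.Language.Term.func (L := pathLang) PathFunc.next ![t]

/-- The atomic formula `ToE(t)`. -/
def toGoal (t : pathLang.Term ℕ) : Atom pathLang := Atom.mk (L := pathLang) PathRel.toGoal ![t]

/-- The atomic formula `FromS(t)`. -/
def fromStart (t : pathLang.Term ℕ) : Atom pathLang :=
  Atom.mk (L := pathLang) PathRel.fromStart ![t]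

/-- The productions for the two predicates:
`ToE(e)`, and `ToE(x)` from `ToE(n x)`; `FromS(s)`, and `FromS(n x)` from `FromS(x)`. -/
def pathProds : ∀ {n : ℕ}, PathRel n → List (Production pathLang n)
  | _, .toGoal => [⟨[], ![goalTerm]⟩, ⟨[toGoal (nextTerm (.var 0))], ![.var 0]⟩]
  | _, .fromStart => [⟨[], ![startTerm]⟩, ⟨[fromStart (.var 0)], ![nextTerm (.var 0)]⟩]

/-- The inductive definition set of the two predicates, both of which are inductive. -/
def pathDefs : IndDefSet pathLang where
  IsInd _ := True
  finite_ind := by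
    refine (Set.toFinite {⟨1, PathRel.toGoal⟩, ⟨1, PathRel.fromStart⟩}).subset ?_
    rintro ⟨_, R⟩ -
    cases R
    · exact Or.inl rfl
    · exact Or.inr rfl
  prods R := pathProds R
  prods_ordinary _ h := absurd trivial h

/-- The sequent `ToE(s) ⊢ FromS(e)`. -/
def pathSequent : Sequent pathLang := ⟨{.atom (toGoal startTerm)}, {.atom (fromStart goalTerm)}⟩

end CLKID

namespace CLKID

open FirstOrder.Language

/-! ## Atomic formulas of the language of the two predicates -/

/-! Unprovability without cut: read `s` as 0, `e` as `⊤` and `n` as successor in `ℕ∞`, with ToE true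
everywhere and FromS true at the finite points only. This refutes ToE(s) ⊢ FromS(e), yet is no
standard model, since ToE should fail at finite points. Without cut, every sequent reached by
following refuted premises upwards has only true equations and ToE on the left, and only FromS on
the right (`Falsifies.exists_premise`). The sole left unfolding is then of ToE: at `⊤` the premise t
= e is taken and nothing progresses; at a finite point the premise ToE(n x) is taken and the traced
value grows by one. So along the refuted path traced values never decrease and grow at each progress
point.

This alone does not exclude infinitely many progress points, as values may climb through all of ℕ. A
cyclic proof, however, contains only finitely many terms, say N. Some g ≤ N is then the value of no
term, and everything beyond this gap can be moved to `⊤` without affecting equations or FromS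
(`Falsifies.collapse`). After each step the traced values lie in {0, …, N, ⊤}, so progress stops,
against the global trace condition (`PreProof.CutFree.not_isProof`).

Provability with cut: cut in FromS(s), generalize to FromS(x), ToE(x) ⊢ FromS(e), and unfold ToE(x).
If x = e this is an axiom; otherwise a cut with FromS(n y) gives the same sequent at n y, and the
loop closes with progress on ToE. -/

theorem Atom.eq_toGoal_or_eq_fromStart (A : Atom pathLang) :
    (∃ t, A = toGoal t) ∨ ∃ t, A = fromStart t := by
  obtain ⟨R, a⟩ := A
  cases R with
  | toGoal =>
    refine Or.inl ⟨a 0, ?_⟩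
    have : a = ![a 0] := by funext i; fin_cases i; rfl
    rw [toGoal, ← this]
  | fromStart =>
    refine Or.inr ⟨a 0, ?_⟩
    have : a = ![a 0] := by funext i; fin_cases i; rfl
    rw [fromStart, ← this]

theorem toGoal_ne_fromStart (t u : pathLang.Term ℕ) : toGoal t ≠ fromStart u := by
  intro h
  cases h

@[simp] theorem toGoal_inj {t u : pathLang.Term ℕ} : toGoal t = toGoal u ↔ t = u := by
  simp [toGoal]

@[simp] theorem fromStart_inj {t u : pathLang.Term ℕ} : fromStart t = fromStart u ↔ t = u := by
  simp [fromStart]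

@[simp] theorem toGoal_subst (t : pathLang.Term ℕ) (θ : ℕ → pathLang.Term ℕ) :
    (toGoal t).subst θ = toGoal (t.subst θ) := by
  simp only [Atom.subst, toGoal, Atom.mk.injEq, heq_eq_eq, true_and]
  funext i; fin_cases i; rfl

@[simp] theorem fromStart_subst (t : pathLang.Term ℕ) (θ : ℕ → pathLang.Term ℕ) :
    (fromStart t).subst θ = fromStart (t.subst θ) := by
  simp only [Atom.subst, fromStart, Atom.mk.injEq, heq_eq_eq, true_and]
  funext i; fin_cases i; rfl

@[simp] theorem startTerm_subst (θ : ℕ → pathLang.Term ℕ) : startTerm.subst θ = startTerm := by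
  simp only [startTerm, Term.subst]
  congr 1
  funext i; exact i.elim0

@[simp] theorem goalTerm_subst (θ : ℕ → pathLang.Term ℕ) : goalTerm.subst θ = goalTerm := by
  simp only [goalTerm, Term.subst]
  congr 1
  funext i; exact i.elim0

@[simp] theorem nextTerm_subst (t : pathLang.Term ℕ) (θ : ℕ → pathLang.Term ℕ) :
    (nextTerm t).subst θ = nextTerm (t.subst θ) := by
  simp only [nextTerm, Term.subst]
  congr 1
  funext i; fin_cases i; rfl

@[simp] theorem goalTerm_relabel (f : ℕ → ℕ) : goalTerm.relabel f = goalTerm := by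
  simp only [goalTerm, Term.relabel]
  congr 1
  funext i; exact i.elim0

/-! ## A nonstandard model -/

/-- The path `0, 1, 2, …` that starts at the start, and an isolated goal `⊤`. -/
instance pathStructure : pathLang.Structure ℕ∞ where
  funMap f a := match f with
    | .start => 0
    | .goal => ⊤
    | .next => a 0 + 1
  RelMap _ _ := True

@[simp] theorem realize_startTerm (ρ : ℕ → ℕ∞) : startTerm.realize ρ = 0 := rfl

@[simp] theorem realize_goalTerm (ρ : ℕ → ℕ∞) : goalTerm.realize ρ = ⊤ := rfl

@[simp] theorem realize_nextTerm (ρ : ℕ → ℕ∞) (t : pathLang.Term ℕ) :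
    (nextTerm t).realize ρ = t.realize ρ + 1 := rfl

/-- The value of the argument of an atomic formula. -/
noncomputable def Atom.val (ρ : ℕ → ℕ∞) (A : Atom pathLang) : ℕ∞ :=
  ∑ i, (A.args i).realize ρ

-- The predicates are unary, so the sum in `Atom.val` has one summand; as a sum it needs no case
-- split on the predicate.
@[simp] theorem val_toGoal (ρ : ℕ → ℕ∞) (t : pathLang.Term ℕ) :
    (toGoal t).val ρ = t.realize ρ :=
  Fin.sum_univ_one _

@[simp] theorem val_subst (ρ : ℕ → ℕ∞) (A : Atom pathLang) (θ : ℕ → pathLang.Term ℕ) :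
    (A.subst θ).val ρ = A.val fun x => (θ x).realize ρ := by
  simp only [Atom.val, Atom.subst, Term.realize_subst]
  rfl

theorem realize_congr {ρ ρ' : ℕ → ℕ∞} (t : pathLang.Term ℕ)
    (h : ∀ x ∈ t.varFinset, ρ x = ρ' x) : t.realize ρ = t.realize ρ' := by
  induction t with
  | var x => exact h x (by simp)
  | func f ts ih =>
    simp only [Term.realize_func]
    congr 1
    funext i
    exact ih i fun x hx => h x (by simpa using ⟨i, hx⟩)

theorem val_congr {ρ ρ' : ℕ → ℕ∞} (A : Atom pathLang) (h : ∀ x ∈ A.fv, ρ x = ρ' x) :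
    A.val ρ = A.val ρ' :=
  Finset.sum_congr rfl fun i _ => realize_congr _ fun x hx => h x ⟨i, hx⟩

/-- `φ` is a true equation or an atomic formula `ToE(t)`. -/
def AntHolds (ρ : ℕ → ℕ∞) : Fml pathLang → Prop
  | .eq t u => t.realize ρ = u.realize ρ
  | .atom A => ∃ t, A = toGoal t
  | _ => False

/-- `φ` is an atomic formula `FromS(t)`, where the value of `t` is the goal. -/
def SucFails (ρ : ℕ → ℕ∞) : Fml pathLang → Prop
  | .atom A => ∃ t, A = fromStart t ∧ t.realize ρ = ⊤
  | _ => False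

/-- `ρ` falsifies the sequent `S`, which consists of equations and `ToE(t)` on the left and of
`FromS(t)` on the right, in the nonstandard model. -/
def Falsifies (ρ : ℕ → ℕ∞) (S : Sequent pathLang) : Prop :=
  (∀ φ ∈ S.ant, AntHolds ρ φ) ∧ ∀ φ ∈ S.suc, SucFails ρ φ

/-! ### Falsification under substitution and change of assignment -/

theorem antHolds_subst {ρ : ℕ → ℕ∞} {φ : Fml pathLang} {θ : ℕ → pathLang.Term ℕ} :
    AntHolds ρ (φ.subst θ) ↔ AntHolds (fun x => (θ x).realize ρ) φ := by
  cases φ with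
  | atom A =>
    simp only [Fml.subst, AntHolds]
    rcases A.eq_toGoal_or_eq_fromStart with ⟨t, rfl⟩ | ⟨t, rfl⟩
    · simp
    · simp [(toGoal_ne_fromStart _ _).symm]
  | _ => simp [Fml.subst, AntHolds]

theorem sucFails_subst {ρ : ℕ → ℕ∞} {φ : Fml pathLang} {θ : ℕ → pathLang.Term ℕ} :
    SucFails ρ (φ.subst θ) ↔ SucFails (fun x => (θ x).realize ρ) φ := by
  cases φ with
  | atom A =>
    simp only [Fml.subst, SucFails]
    rcases A.eq_toGoal_or_eq_fromStart with ⟨t, rfl⟩ | ⟨t, rfl⟩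
    · simp [toGoal_ne_fromStart]
    · simp
  | _ => simp [Fml.subst, SucFails]

theorem falsifies_subst {ρ : ℕ → ℕ∞} {Γ Δ : Finset (Fml pathLang)} {θ : ℕ → pathLang.Term ℕ} :
    Falsifies ρ ⟨substSet Γ θ, substSet Δ θ⟩ ↔
      Falsifies (fun x => (θ x).realize ρ) ⟨Γ, Δ⟩ := by
  simp [Falsifies, substSet, antHolds_subst, sucFails_subst]

theorem antHolds_congr {ρ ρ' : ℕ → ℕ∞} {φ : Fml pathLang} (h : ∀ x ∈ φ.fv, ρ x = ρ' x)
    (hφ : AntHolds ρ φ) : AntHolds ρ' φ := by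
  cases φ with
  | eq t u =>
    simp only [AntHolds] at hφ ⊢
    rw [← realize_congr t fun x hx => h x (Or.inl hx), hφ,
      realize_congr u fun x hx => h x (Or.inr hx)]
  | _ => exact hφ

theorem sucFails_congr {ρ ρ' : ℕ → ℕ∞} {φ : Fml pathLang} (h : ∀ x ∈ φ.fv, ρ x = ρ' x)
    (hφ : SucFails ρ φ) : SucFails ρ' φ := by
  cases φ with
  | atom A =>
    obtain ⟨t, rfl, ht⟩ := hφ
    exact ⟨t, rfl, (realize_congr t fun x hx => h x ⟨(0 : Fin 1), hx⟩) ▸ ht⟩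
  | _ => exact hφ

/-! ## Cut-free rules propagate falsification -/

theorem realize_subst₂_comm {ρ : ℕ → ℕ∞} {t u : pathLang.Term ℕ}
    (h : t.realize ρ = u.realize ρ) (x y : ℕ) :
    (fun z => (subst₂ x t y u z).realize ρ) = fun z => (subst₂ x u y t z).realize ρ := by
  funext z
  simp only [subst₂]
  split_ifs <;> simp [h]

/-- For traces from `A` to `B`, the value does not decrease, and it increases at progress points. -/
def TraceIncreases (ρ : ℕ → ℕ∞) (r : Rule pathLang) (n : ℕ) (S : Sequent pathLang)
    (ρ' : ℕ → ℕ∞) : Prop :=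
  ∀ A B, Fml.atom A ∈ r.concl.ant → Fml.atom B ∈ S.ant → r.TraceStep pathDefs n A B →
    A.val ρ ≤ B.val ρ' ∧ (r.CaseDescendant pathDefs n A B → A.val ρ < B.val ρ')

/-- The unfolded formula must be ToE(t), and the value of t decides which premise is falsified. -/
theorem Falsifies.exists_case {ρ : ℕ → ℕ∞} {Γ Δ : Finset (Fml pathLang)} {m : ℕ}
    {P : pathLang.Relations m} {u : Fin m → pathLang.Term ℕ}
    {σ : Production pathLang m → ℕ → ℕ}
    (hs : (Rule.case Γ Δ P u σ).SideCondition pathDefs)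
    (hf : Falsifies ρ (Rule.case Γ Δ P u σ).concl) :
    ∃ n S ρ', ((Rule.case Γ Δ P u σ).prems pathDefs)[n]? = some S ∧ Falsifies ρ' S ∧
      TraceIncreases ρ (Rule.case Γ Δ P u σ) n S ρ' := by
  obtain ⟨-, hs⟩ := hs
  obtain ⟨hΓ, hΔ⟩ := hf
  simp only [Rule.concl, Finset.mem_insert, forall_eq_or_imp] at hΓ hΔ
  obtain ⟨⟨t, ht⟩, hΓ⟩ := hΓ
  cases P with
  | fromStart =>
    -- FromS does not occur on the left of a falsified sequent.
    cases ht
  | toGoal =>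
    obtain rfl : u = ![t] := by
      simpa [toGoal] using ht
    by_cases htop : t.realize ρ = ⊤
    · refine ⟨0, _, ρ, rfl, ⟨?_, hΔ⟩, ?_⟩
      · intro φ hφ
        simp only [caseDistinction, Finset.mem_union, List.map_nil, List.toFinset_nil,
          Finset.mem_image, Finset.mem_univ, true_and, Finset.notMem_empty, or_false] at hφ
        rcases hφ with hφ | ⟨i, rfl⟩
        · exact hΓ φ hφ
        · fin_cases i
          simpa [AntHolds] using htop
      · intro A B _ _ hAB
        -- The production ToE(e) has no assumptions, hence no case-descendants: traces pass without
        -- progress.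
        have hn : ¬ (Rule.case Γ Δ PathRel.toGoal ![t] σ).CaseDescendant pathDefs 0 A B := by
          rintro ⟨-, p, hp, C, hC, -⟩
          obtain rfl : (⟨[], ![goalTerm]⟩ : Production pathLang 1) = p := by
            simpa [pathDefs, pathProds] using hp
          simp at hC
        rcases hAB with hAB | rfl
        · exact absurd hAB hn
        · exact ⟨le_rfl, fun h => absurd h hn⟩
    · set p : Production pathLang 1 := ⟨[toGoal (nextTerm (.var 0))], ![.var 0]⟩ with hp
      have hvar : (0 : ℕ) ∈ p.vars := Or.inr ⟨0, by simp [hp]⟩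
      obtain ⟨-, hfresh⟩ := hs p (by simp [pathDefs, pathProds, hp])
      obtain ⟨h1, h2, h3⟩ := hfresh 0 hvar
      set z := σ p 0 with hz
      -- The fresh variable takes the value of t, which makes the new equation true and disturbs
      -- nothing else.
      set ρ' := Function.update ρ z (t.realize ρ) with hρ'
      have hρz : ∀ x, x ≠ z → ρ x = ρ' x := fun x hx => by simp [hρ', hx]
      have htt : t.realize ρ' = t.realize ρ :=
        (realize_congr t fun x hx => hρz x (by rintro rfl; exact h3 ⟨0, hx⟩)).symm
      refine ⟨1, caseDistinction Γ Δ ![t] p (σ p), ρ', rfl, ⟨?_, ?_⟩, ?_⟩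
      · intro φ hφ
        simp only [caseDistinction, Finset.mem_union, List.map_cons, List.map_nil,
          Finset.mem_image, Finset.mem_univ, true_and, List.mem_toFinset, List.mem_singleton,
          hp] at hφ
        rcases hφ with (hφ | ⟨i, rfl⟩) | rfl
        · exact antHolds_congr (fun x hx => hρz x (by rintro rfl; exact h1 ⟨φ, hφ, hx⟩)) (hΓ φ hφ)
        · fin_cases i
          simp only [AntHolds]
          change t.realize ρ' = ρ' z
          rw [htt, hρ', Function.update_self]
        · exact ⟨_, toGoal_subst _ _⟩
      · intro φ hφ
        exact sucFails_congr (fun x hx => hρz x (by rintro rfl; exact h2 ⟨φ, hφ, hx⟩)) (hΔ φ hφ)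
      · intro A B hA _ hAB
        have hd : (Rule.case Γ Δ PathRel.toGoal ![t] σ).CaseDescendant pathDefs 1 A B →
            A.val ρ < B.val ρ' := by
          rintro ⟨rfl, q, hq, C, hC, -, rfl⟩
          obtain rfl : p = q := by simpa [pathDefs, pathProds] using hq
          obtain rfl : C = toGoal (nextTerm (.var 0)) := by simpa [hp] using hC
          change (toGoal t).val ρ < _
          rw [toGoal_subst, val_toGoal, val_toGoal, nextTerm_subst, realize_nextTerm]
          change _ < ρ' z + 1
          rw [hρ', Function.update_self]
          -- Strict growth needs a finite value, since ⊤ + 1 = ⊤.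
          exact (ENat.lt_add_one_iff htop).2 le_rfl
        rcases hAB with hAB | rfl
        · exact ⟨(hd hAB).le, hd⟩
        · refine ⟨le_of_eq (val_congr _ fun x hx => hρz x ?_), hd⟩
          rintro rfl
          simp only [Rule.concl, Finset.mem_insert, Fml.atom.injEq] at hA
          rcases hA with rfl | hA
          · exact h3 hx
          · exact h1 ⟨_, hA, hx⟩

theorem Falsifies.exists_premise {ρ : ℕ → ℕ∞} {r : Rule pathLang}
    (hs : r.SideCondition pathDefs) (hc : ¬ r.IsCut) (hf : Falsifies ρ r.concl) :
    ∃ n S ρ', (r.prems pathDefs)[n]? = some S ∧ Falsifies ρ' S ∧ TraceIncreases ρ r n S ρ' := by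
  cases r with
  | case Γ Δ P u σ => exact hf.exists_case hs
  | ax Γ Δ =>
    obtain ⟨φ, hφ⟩ := hs
    rw [Finset.mem_inter] at hφ
    have h1 := hf.1 φ hφ.1
    have h2 := hf.2 φ hφ.2
    cases φ with
    | atom A =>
      obtain ⟨t, rfl⟩ := h1
      obtain ⟨u, hu, -⟩ := h2
      exact absurd hu (toGoal_ne_fromStart _ _)
    | _ => exact h2.elim
  | weak Γ' Δ' Γ Δ =>
    refine ⟨0, _, ρ, rfl, ⟨fun φ h => hf.1 φ (hs.1 h), fun φ h => hf.2 φ (hs.2 h)⟩, ?_⟩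
    rintro A B - - rfl
    exact ⟨le_rfl, False.elim⟩
  | cut => exact absurd trivial hc
  | subst Γ Δ θ =>
    refine ⟨0, _, _, rfl, falsifies_subst.1 hf, ?_⟩
    rintro A B - - rfl
    exact ⟨(val_subst _ _ _).le, False.elim⟩
  | eqL Γ Δ x y t u =>
    have htu : t.realize ρ = u.realize ρ := hf.1 (.eq t u) (Finset.mem_insert_self _ _)
    refine ⟨0, _, ρ, rfl, ?_, ?_⟩
    -- As t and u have equal values, both substitutions induce the same assignment.
    · rw [falsifies_subst, ← realize_subst₂_comm htu, ← falsifies_subst]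
      exact ⟨fun φ h => hf.1 φ (Finset.mem_insert_of_mem h), hf.2⟩
    · rintro A B - - ⟨C, x', y', -, rfl, rfl⟩
      rw [val_subst, val_subst, realize_subst₂_comm htu]
      exact ⟨le_rfl, False.elim⟩
  | indR Γ Δ P p θ =>
    obtain ⟨-, hp⟩ := hs
    have hP := hf.2 _ (Finset.mem_insert_self _ _)
    obtain ⟨t, ht, htop⟩ := hP
    cases P with
    | toGoal => cases ht
    | fromStart =>
      simp only [pathDefs, pathProds, List.mem_cons, List.not_mem_nil, or_false] at hp
      have ht' := congrFun (show (fun i => (p.args i).subst θ) = ![t] by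
        simpa [fromStart] using ht) 0
      simp only [Matrix.cons_val_fin_one] at ht'
      subst ht'
      rcases hp with rfl | rfl
      -- FromS(s) is true, as 0 ≠ ⊤, so this production cannot yield a falsified conclusion.
      · simp at htop
      · refine ⟨0, _, ρ, rfl, ⟨hf.1, ?_⟩, ?_⟩
        · simp only [Finset.mem_insert, forall_eq_or_imp, fromStart_subst]
          -- v + 1 = ⊤ forces v = ⊤.
          exact ⟨⟨_, rfl, by simpa using htop⟩, fun φ h => hf.2 φ (Finset.mem_insert_of_mem h)⟩
        · rintro A B - - rfl
          exact ⟨le_rfl, False.elim⟩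
  -- The remaining rules have a principal formula of a shape that falsified sequents exclude.
  | negL | andL | orL | impL | allL | exL => exact (hf.1 _ (Finset.mem_insert_self _ _)).elim
  | negR | andR | orR | impR | allR | exR | eqR =>
    exact (hf.2 _ (Finset.mem_insert_self _ _)).elim

/-! ## Collapsing far points to the goal -/

/-- The subterms of a term. -/
def subterms : pathLang.Term ℕ → Set (pathLang.Term ℕ)
  | .var x => {.var x}
  | .func f ts => insert (.func f ts) (⋃ i, subterms (ts i))

theorem finite_subterms (t : pathLang.Term ℕ) : (subterms t).Finite := by
  induction t with
  | var x => exact Set.finite_singleton _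
  | func f ts ih => exact (Set.finite_iUnion ih).insert _

theorem mem_subterms_self (t : pathLang.Term ℕ) : t ∈ subterms t := by
  cases t with
  | var x => exact rfl
  | func f ts => exact Set.mem_insert _ _

/-- The terms in equations and atomic formulas. -/
def Fml.terms : Fml pathLang → Set (pathLang.Term ℕ)
  | .eq t u => subterms t ∪ subterms u
  | .atom A => ⋃ i, subterms (A.args i)
  | _ => ∅

theorem Fml.finite_terms (φ : Fml pathLang) : φ.terms.Finite := by
  cases φ with
  | eq t u => exact (finite_subterms t).union (finite_subterms u)
  | atom A => exact Set.finite_iUnion fun i => finite_subterms _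
  | _ => exact Set.finite_empty

/-- The terms in the formulas of a sequent. -/
def Sequent.terms (S : Sequent pathLang) : Set (pathLang.Term ℕ) :=
  ⋃ φ ∈ S.ant ∪ S.suc, φ.terms

theorem Sequent.finite_terms (S : Sequent pathLang) : S.terms.Finite :=
  (S.ant ∪ S.suc).finite_toSet.biUnion fun φ _ => φ.finite_terms

/-- All points beyond `g` are collapsed to the goal. -/
noncomputable def collapse (g v : ℕ∞) : ℕ∞ := if v ≤ g then v else ⊤

theorem le_collapse (g v : ℕ∞) : v ≤ collapse g v := by
  unfold collapse
  split_ifs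
  · exact le_rfl
  · exact le_top

theorem collapse_le_or_eq_top (g v : ℕ∞) : collapse g v ≤ g ∨ collapse g v = ⊤ := by
  unfold collapse
  split_ifs with h
  · exact Or.inl h
  · exact Or.inr rfl

theorem collapse_top (g : ℕ∞) : collapse g ⊤ = ⊤ := by
  simp [collapse]

/-- For finite g, the step from g to g + 1 is the only one that leaves the kept segment; avoiding
it, collapsing commutes with successor. -/
theorem collapse_add_one {g v : ℕ∞} (h : v ≠ g) : collapse g (v + 1) = collapse g v + 1 := by
  unfold collapse
  by_cases hv : v < g
  · rw [if_pos hv.le, if_pos (Order.add_one_le_of_lt hv)]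
  · have hgv : g < v := lt_of_le_of_ne (not_lt.1 hv) h.symm
    rw [if_neg hgv.not_ge, if_neg (hgv.trans_le le_self_add).not_ge, top_add]

theorem realize_collapse {ρ : ℕ → ℕ∞} {g : ℕ∞} (t : pathLang.Term ℕ)
    (h : ∀ u ∈ subterms t, u.realize ρ ≠ g) :
    t.realize (fun x => collapse g (ρ x)) = collapse g (t.realize ρ) := by
  induction t with
  | var x => rfl
  | func f ts ih =>
    cases f with
    | start => exact (if_pos zero_le).symm
    | goal => exact (collapse_top g).symm
    | next =>
      have ih0 := ih 0 fun u hu => h u (Or.inr (Set.mem_iUnion.2 ⟨0, hu⟩))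
      change (ts 0).realize _ + 1 = collapse g ((ts 0).realize ρ + 1)
      rw [ih0, collapse_add_one]
      exact h _ (Or.inr (Set.mem_iUnion.2 ⟨0, mem_subterms_self _⟩))

/-- If no term takes the value g, collapsing acts as a homomorphism on the terms of the sequent, so
it preserves equations, and it fixes ⊤. -/
theorem Falsifies.collapse {ρ : ℕ → ℕ∞} {S : Sequent pathLang} (hf : Falsifies ρ S) {g : ℕ∞}
    (h : ∀ u ∈ S.terms, u.realize ρ ≠ g) :
    Falsifies (fun x => CLKID.collapse g (ρ x)) S ∧
      ∀ A, Fml.atom A ∈ S.ant →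
        A.val (fun x => CLKID.collapse g (ρ x)) = CLKID.collapse g (A.val ρ) := by
  have hterm : ∀ φ ∈ S.ant ∪ S.suc, ∀ u ∈ φ.terms, u.realize ρ ≠ g := fun φ hφ u hu =>
    h u (Set.mem_iUnion₂.2 ⟨φ, hφ, hu⟩)
  refine ⟨⟨fun φ hφ => ?_, fun φ hφ => ?_⟩, fun A hA => ?_⟩
  · have h1 := hf.1 φ hφ
    have h2 := hterm φ (Finset.mem_union_left _ hφ)
    cases φ with
    | eq t u =>
      simp only [AntHolds] at h1 ⊢
      rw [realize_collapse t fun w hw => h2 w (Or.inl hw),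
        realize_collapse u fun w hw => h2 w (Or.inr hw), h1]
    | _ => exact h1
  · have h1 := hf.2 φ hφ
    have h2 := hterm φ (Finset.mem_union_right _ hφ)
    cases φ with
    | atom A =>
      obtain ⟨t, rfl, ht⟩ := h1
      refine ⟨t, rfl, ?_⟩
      rw [realize_collapse t fun w hw => h2 w (Set.mem_iUnion.2 ⟨(0 : Fin 1), hw⟩), ht, collapse_top]
    | _ => exact h1
  · have h2 := hterm _ (Finset.mem_union_left _ hA)
    obtain ⟨t, rfl⟩ := hf.1 _ hA
    rw [val_toGoal, val_toGoal]
    exact realize_collapse t fun w hw => h2 w (Set.mem_iUnion.2 ⟨(0 : Fin 1), hw⟩)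

/-- Pigeonhole on the N + 1 candidates 0, …, N. -/
theorem exists_natCast_notMem_of_card_le {V : Finset ℕ∞} {N : ℕ} (h : V.card ≤ N) :
    ∃ g : ℕ, g ≤ N ∧ (g : ℕ∞) ∉ V := by
  by_contra! hV
  have h1 : (Finset.range (N + 1)).image (Nat.cast : ℕ → ℕ∞) ⊆ V := by
    intro x hx
    obtain ⟨g, hg, rfl⟩ := Finset.mem_image.1 hx
    exact hV g (Nat.lt_succ_iff.1 (Finset.mem_range.1 hg))
  have h2 := Finset.card_le_card h1
  rw [Finset.card_image_of_injective _ Nat.cast_injective, Finset.card_range] at h2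
  omega

/-- The premise of `Falsifies.exists_premise` is falsified with values that are bounded in terms of
the number of terms in the proof. -/
theorem Falsifies.exists_bounded_premise (T : Finset (pathLang.Term ℕ)) {ρ : ℕ → ℕ∞}
    {r : Rule pathLang} (hs : r.SideCondition pathDefs) (hc : ¬ r.IsCut)
    (hf : Falsifies ρ r.concl) (hT : ∀ S ∈ r.prems pathDefs, S.terms ⊆ T) :
    ∃ n S ρ', (r.prems pathDefs)[n]? = some S ∧ Falsifies ρ' S ∧ TraceIncreases ρ r n S ρ' ∧
      ∀ A, Fml.atom A ∈ S.ant → A.val ρ' ≤ T.card ∨ A.val ρ' = ⊤ := by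
  obtain ⟨n, S, ρ', hn, hS, htr⟩ := hf.exists_premise hs hc
  obtain ⟨g, hg, hgT⟩ := exists_natCast_notMem_of_card_le
    (Finset.card_image_le (s := T) (f := fun t => t.realize ρ'))
  have hval : ∀ u ∈ S.terms, u.realize ρ' ≠ g := fun u hu h =>
    hgT (Finset.mem_image.2 ⟨u, hT S (List.mem_of_getElem? hn) hu, h⟩)
  obtain ⟨h1, h2⟩ := hS.collapse hval
  refine ⟨n, S, _, hn, h1, fun A B hA hB hAB => ?_, fun A hA => ?_⟩
  · obtain ⟨h3, h4⟩ := htr A B hA hB hAB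
    rw [h2 B hB]
    -- Collapsing only raises values, so growth along traces survives.
    exact ⟨h3.trans (le_collapse _ _), fun h => (h4 h).trans_le (le_collapse _ _)⟩
  · rw [h2 A hA]
    exact (collapse_le_or_eq_top g _).imp_left fun h => h.trans (by exact_mod_cast hg)

/-! ## Tree-unfoldings -/

section Unfolding

variable {L : FirstOrder.Language.{0, 0}} {Φ : IndDefSet L} (π : PreProof Φ)

theorem PreProof.follow_append (σ : List ℕ) (n : ℕ) :
    π.follow [] (σ ++ [n]) = π.resolve (π.follow [] σ ++ [n]) := by
  simp [PreProof.follow]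

/-- Resolving replaces a bud by an inner node with the same sequent, so the unfolding has no buds.
-/
theorem PreProof.exists_tree_resolve {ν : List ℕ} {S : Sequent L} {l : Option (Rule L)}
    (h : π.tree ν = some (S, l)) : ∃ r, π.tree (π.resolve ν) = some (S, some r) := by
  unfold PreProof.resolve
  split_ifs with hb
  · obtain ⟨S', hS'⟩ := hb
    obtain rfl : S' = S := by
      rw [h] at hS'
      simp only [Option.some.injEq, Prod.mk.injEq] at hS'
      exact hS'.1.symm
    exact π.companion_spec ν S' hS'
  · cases l with
    | none => exact absurd ⟨S, h⟩ hb
    | some r => exact ⟨r, h⟩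

theorem PreProof.exists_unfolding_child {σ : List ℕ} {S : Sequent L} {r : Rule L}
    (h : π.unfolding σ = some (S, some r)) {n : ℕ} {S' : Sequent L}
    (hn : (r.prems Φ)[n]? = some S') : ∃ r', π.unfolding (σ ++ [n]) = some (S', some r') := by
  have h1 := (π.isDerivation.rule _ _ _ h).2.2 n
  rw [hn, Option.map_eq_some_iff] at h1
  obtain ⟨⟨S'', l⟩, h2, rfl⟩ := h1
  obtain ⟨r', hr'⟩ := π.exists_tree_resolve h2
  exact ⟨r', by rw [PreProof.unfolding, PreProof.follow_append, hr']⟩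

end Unfolding

/-! ## The sequent is not cut-free provable -/

/-- The sequents of a pre-proof contain finitely many terms. -/
theorem PreProof.exists_terms_subset (π : PreProof pathDefs) :
    ∃ T : Finset (pathLang.Term ℕ), ∀ ν S l, π.tree ν = some (S, l) → S.terms ⊆ T := by
  have hfin : (⋃ ν ∈ {ν | π.tree ν ≠ none},
      (π.tree ν).elim ∅ fun a => a.1.terms : Set (pathLang.Term ℕ)).Finite := by
    refine π.finite.biUnion fun ν _ => ?_
    cases h : π.tree ν with
    | none => exact Set.finite_empty
    | some a => exact a.1.finite_terms
  refine ⟨hfin.toFinset, fun ν S l h t ht => ?_⟩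
  rw [Set.Finite.coe_toFinset]
  refine Set.mem_iUnion₂.2 ⟨ν, by simp [h], ?_⟩
  rw [h]
  exact ht

/-- A node of the unfolding whose sequent is falsified with bounded values. -/
def PreProof.FalsifiedNode (π : PreProof pathDefs) (N : ℕ) (s : List ℕ × (ℕ → ℕ∞)) : Prop :=
  ∃ S r, π.unfolding s.1 = some (S, some r) ∧ Falsifies s.2 S ∧
    ∀ A, Fml.atom A ∈ S.ant → A.val s.2 ≤ N ∨ A.val s.2 = ⊤

/-- One step of the refuting path, in a form that can be iterated: the bound `T.card` comes from the
whole finite tree and stays the same at every step. -/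
theorem PreProof.CutFree.exists_child {π : PreProof pathDefs} (hc : π.CutFree)
    {T : Finset (pathLang.Term ℕ)} (hT : ∀ ν S l, π.tree ν = some (S, l) → S.terms ⊆ T)
    (s : {s // π.FalsifiedNode T.card s}) :
    ∃ s' : {s // π.FalsifiedNode T.card s}, ∃ n, s'.1.1 = s.1.1 ++ [n] ∧
      ∀ S r S' l, π.unfolding s.1.1 = some (S, some r) → π.unfolding s'.1.1 = some (S', l) →
        TraceIncreases s.1.2 r n S' s'.1.2 := by
  obtain ⟨⟨σ, ρ⟩, S, r, hu, hf, -⟩ := s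
  obtain ⟨hside, rfl, hprem⟩ := π.isDerivation.rule _ _ _ hu
  obtain ⟨n, S', ρ', hn, hf', htr, hb⟩ := hf.exists_bounded_premise T hside (hc _ _ _ hu) (by
    intro S' hS'
    obtain ⟨n, hn⟩ := List.mem_iff_getElem?.1 hS'
    have h1 := hprem n
    rw [hn, Option.map_eq_some_iff] at h1
    obtain ⟨⟨S'', l⟩, h2, rfl⟩ := h1
    exact hT _ _ _ h2)
  obtain ⟨r', hr'⟩ := π.exists_unfolding_child hu hn
  refine ⟨⟨(σ ++ [n], ρ'), S', r', hr', hf', hb⟩, n, rfl, fun S₁ r₁ S₂ l₂ h₁ h₂ => ?_⟩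
  simp only at h₁ h₂ hu
  rw [hu] at h₁
  rw [hr'] at h₂
  simp only [Option.some.injEq, Prod.mk.injEq] at h₁ h₂
  obtain ⟨rfl, rfl⟩ := h₁
  obtain ⟨rfl, rfl⟩ := h₂
  exact htr

/-- Iterating the step gives an infinite path on which any trace is nondecreasing in a finite set of
values, so it progresses finitely often. -/
theorem PreProof.CutFree.not_isProof {π : PreProof pathDefs} (hc : π.CutFree)
    {T : Finset (pathLang.Term ℕ)} (hT : ∀ ν S l, π.tree ν = some (S, l) → S.terms ⊆ T)
    (s₀ : {s // π.FalsifiedNode T.card s}) : ¬ π.IsProof := by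
  intro hproof
  choose next hnext using hc.exists_child hT
  set x : ℕ → {s // π.FalsifiedNode T.card s} := fun i => next^[i] s₀ with hx
  have hxs : ∀ i, x (i + 1) = next (x i) := fun i => Function.iterate_succ_apply' _ _ _
  obtain ⟨k, τ, ⟨hτ, hstep⟩, hprog⟩ := hproof (fun i => (x i).1.1) ⟨fun i => by
      obtain ⟨S, r, h, -⟩ := (x i).2
      simp [h], fun i => by
      obtain ⟨n, hn, -⟩ := hnext (x i)
      exact ⟨n, (congrArg (fun s => s.1.1) (hxs i)).trans hn⟩⟩
  have hval : ∀ i, (τ i).val (x (k + i)).1.2 ≤ (τ (i + 1)).val (x (k + (i + 1))).1.2 ∧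
      (π.unfolding.IsProgress pathDefs (fun i => (x (k + i)).1.1) τ i →
        (τ i).val (x (k + i)).1.2 < (τ (i + 1)).val (x (k + (i + 1))).1.2) := by
    intro i
    obtain ⟨S, r, hS, -⟩ := (x (k + i)).2
    obtain ⟨S', r', hS', -⟩ := (x (k + (i + 1))).2
    obtain ⟨n, hn, htr⟩ := hnext (x (k + i))
    rw [← hxs, add_assoc] at hn htr
    have hA := (hτ i).2 _ _ hS
    have hB := (hτ (i + 1)).2 _ _ hS'
    rw [← (π.isDerivation.rule _ _ _ hS).2.1] at hA
    obtain ⟨h1, h2⟩ := htr _ _ _ _ hS hS' _ _ hA hB (hstep i S r n hS hn)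
    refine ⟨h1, ?_⟩
    rintro ⟨S₁, r₁, n₁, h₁, hn₁, hd⟩
    simp only at h₁ hn₁
    rw [hS] at h₁
    rw [hn] at hn₁
    simp only [Option.some.injEq, Prod.mk.injEq] at h₁
    obtain ⟨rfl, rfl⟩ := h₁
    obtain rfl : n = n₁ := by simpa using hn₁
    exact h2 hd
  set v : ℕ → ℕ∞ := fun i => (τ i).val (x (k + i)).1.2 with hv
  have hmono : Monotone v := monotone_nat_of_le_succ fun i => (hval i).1
  have hmaps : Set.MapsTo v {i | π.unfolding.IsProgress pathDefs (fun i => (x (k + i)).1.1) τ i}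
      (insert ⊤ (Nat.cast '' Set.Iic T.card)) := by
    intro i _
    obtain ⟨S, r, hS, -, hb⟩ := (x (k + i)).2
    rcases hb _ ((hτ i).2 _ _ hS) with h | h
    · obtain ⟨m, hm⟩ := ENat.ne_top_iff_exists.1 (ne_top_of_le_ne_top (ENat.natCast_ne_top _) h)
      rw [← hm] at h
      exact Or.inr ⟨m, by exact_mod_cast h, hm⟩
    · exact Or.inl h
  -- Two progress points share a value, although the value rises strictly after the earlier one.
  obtain ⟨i, hi, j, hj, hne, heq⟩ := hprog.exists_ne_map_eq_of_mapsTo hmaps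
    (((Set.finite_Iic _).image _).insert _)
  rcases lt_or_gt_of_ne hne with h | h
  · exact (((hval i).2 hi).trans_le (hmono h)).ne heq
  · exact (((hval j).2 hj).trans_le (hmono h)).ne heq.symm

theorem not_cutFreeProvable_pathSequent : ¬ CutFreeProvable pathDefs pathSequent := by
  rintro ⟨π, ⟨l, hl⟩, hproof, hc⟩
  obtain ⟨T, hT⟩ := π.exists_terms_subset
  obtain ⟨r, hr⟩ := π.exists_tree_resolve hl
  refine hc.not_isProof hT ⟨([], fun _ => 0), pathSequent, r, hr, ⟨?_, ?_⟩, ?_⟩ hproof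
  · simp [pathSequent, AntHolds]
  · simp [pathSequent, SucFails]
  · simp [pathSequent]

/-! ## The sequent is provable -/

/-- The formula `ToE(t)`. -/
abbrev toGoalFml (t : pathLang.Term ℕ) : Fml pathLang := .atom (toGoal t)

/-- The formula `FromS(t)`. -/
abbrev fromStartFml (t : pathLang.Term ℕ) : Fml pathLang := .atom (fromStart t)

/-- The term that consists of a variable. -/
abbrev varTerm (x : ℕ) : pathLang.Term ℕ := .var x

/-- The rule at an inner node of the cyclic proof. -/
noncomputable def cyclicRule : List ℕ → Option (Rule pathLang)
  | [] => some (.cut {toGoalFml startTerm} {fromStartFml goalTerm} (fromStartFml startTerm))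
  | [0] => some (.indR {toGoalFml startTerm} {fromStartFml goalTerm} PathRel.fromStart
      ⟨[], ![startTerm]⟩ varTerm)
  -- Only variable 0 occurs, so a constant substitution suffices.
  | [1] => some (.subst {fromStartFml (varTerm 0), toGoalFml (varTerm 0)}
      {fromStartFml goalTerm} fun _ => startTerm)
  | [1, 0] => some (.case {fromStartFml (varTerm 0)} {fromStartFml goalTerm} PathRel.toGoal
      ![varTerm 0] fun _ => Nat.succ)
  -- Variable 2 marks the position to rewrite; variable 3 occurs nowhere and is a dummy.
  | [1, 0, 0] => some (.eqL {fromStartFml (varTerm 2)} {fromStartFml goalTerm} 2 3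
      (varTerm 0) goalTerm)
  | [1, 0, 0, 0] => some (.ax {fromStartFml goalTerm} {fromStartFml goalTerm})
  | [1, 0, 1] => some (.eqL {fromStartFml (varTerm 2), toGoalFml (nextTerm (varTerm 1))}
      {fromStartFml goalTerm} 2 3 (varTerm 0) (varTerm 1))
  | [1, 0, 1, 0] => some (.cut {fromStartFml (varTerm 1), toGoalFml (nextTerm (varTerm 1))}
      {fromStartFml goalTerm} (fromStartFml (nextTerm (varTerm 1))))
  | [1, 0, 1, 0, 0] => some (.indR {fromStartFml (varTerm 1), toGoalFml (nextTerm (varTerm 1))}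
      {fromStartFml goalTerm} PathRel.fromStart
      ⟨[fromStart (varTerm 0)], ![nextTerm (varTerm 0)]⟩ fun _ => varTerm 1)
  | [1, 0, 1, 0, 0, 0] => some (.ax {fromStartFml (varTerm 1), toGoalFml (nextTerm (varTerm 1))}
      {fromStartFml (varTerm 1), fromStartFml goalTerm})
  | [1, 0, 1, 0, 1] => some (.weak
      {fromStartFml (nextTerm (varTerm 1)), toGoalFml (nextTerm (varTerm 1))}
      {fromStartFml goalTerm}
      {fromStartFml (nextTerm (varTerm 1)), fromStartFml (varTerm 1),
        toGoalFml (nextTerm (varTerm 1))} {fromStartFml goalTerm})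
  | [1, 0, 1, 0, 1, 0] => some (.subst {fromStartFml (varTerm 0), toGoalFml (varTerm 0)}
      {fromStartFml goalTerm} fun _ => nextTerm (varTerm 1))
  | _ => none

/-- The sequent `FromS(x), ToE(x) ⊢ FromS(e)`, the conclusion of the companion. -/
noncomputable def cycleSequent : Sequent pathLang :=
  ⟨{fromStartFml (varTerm 0), toGoalFml (varTerm 0)}, {fromStartFml goalTerm}⟩

open Classical in
/-- The derivation tree of the cyclic proof, with one bud. -/
noncomputable def cyclicTree : Tree pathLang := fun ν =>
  if ν = [1, 0, 1, 0, 1, 0, 0] then some (cycleSequent, none)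
  else (cyclicRule ν).map fun r => (r.concl, some r)

/-- The inner nodes of the cyclic proof. -/
inductive CyclicNode : List ℕ → Prop
  | root : CyclicNode []
  | start : CyclicNode [0]
  | generalize : CyclicNode [1]
  | case : CyclicNode [1, 0]
  | goal : CyclicNode [1, 0, 0]
  | goalAx : CyclicNode [1, 0, 0, 0]
  | step : CyclicNode [1, 0, 1]
  | stepCut : CyclicNode [1, 0, 1, 0]
  | unfold : CyclicNode [1, 0, 1, 0, 0]
  | unfoldAx : CyclicNode [1, 0, 1, 0, 0, 0]
  | forget : CyclicNode [1, 0, 1, 0, 1]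
  | back : CyclicNode [1, 0, 1, 0, 1, 0]

/-! ### The tree is a pre-proof -/

theorem cyclicNode_of_cyclicRule {ν : List ℕ} {r : Rule pathLang} (h : cyclicRule ν = some r) :
    CyclicNode ν := by
  unfold cyclicRule at h
  split at h <;> first | constructor | cases h

theorem cyclicTree_eq_some {ν : List ℕ} {S : Sequent pathLang} {l : Option (Rule pathLang)}
    (h : cyclicTree ν = some (S, l)) :
    (ν = [1, 0, 1, 0, 1, 0, 0] ∧ S = cycleSequent ∧ l = none) ∨
      ∃ r, CyclicNode ν ∧ cyclicRule ν = some r ∧ S = r.concl ∧ l = some r := by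
  unfold cyclicTree at h
  split_ifs at h with hν
  · simp only [Option.some.injEq, Prod.mk.injEq] at h
    exact Or.inl ⟨hν, h.1.symm, h.2.symm⟩
  · rw [Option.map_eq_some_iff] at h
    obtain ⟨r, hr, h⟩ := h
    simp only [Prod.mk.injEq] at h
    exact Or.inr ⟨r, cyclicNode_of_cyclicRule hr, hr, h.1.symm, h.2.symm⟩

theorem cyclicNode_of_cyclicTree {ν : List ℕ} (h : cyclicTree ν ≠ none) :
    ν = [1, 0, 1, 0, 1, 0, 0] ∨ CyclicNode ν := by
  obtain ⟨⟨S, l⟩, h⟩ := Option.ne_none_iff_exists'.1 h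
  rcases cyclicTree_eq_some h with h | ⟨r, h, -⟩
  · exact Or.inl h.1
  · exact Or.inr h

theorem fv_mk {L : FirstOrder.Language.{0, 0}} (R : L.Relations 1) (t : L.Term ℕ) :
    (Atom.mk R ![t]).fv = t.varFinset := by
  ext x
  simp [Atom.fv]

theorem cyclicRule_sideCondition {ν : List ℕ} {r : Rule pathLang} (h : cyclicRule ν = some r) :
    r.SideCondition pathDefs := by
  cases cyclicNode_of_cyclicRule h <;> obtain rfl := Option.some.inj h
  case root | generalize | stepCut | back => exact trivial
  case start => exact ⟨trivial, by simp [pathDefs, pathProds]⟩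
  case case =>
    refine ⟨trivial, fun p _ => ⟨Nat.succ_injective.injOn, fun x _ => ⟨?_, ?_, ?_⟩⟩⟩
    all_goals simp [fvSet, Fml.fv, fv_mk, fromStart, goalTerm]
  case goal | step => exact (by decide : (2 : ℕ) ≠ 3)
  case goalAx => exact ⟨fromStartFml goalTerm, by simp⟩
  case unfoldAx => exact ⟨fromStartFml (varTerm 1), by simp⟩
  case unfold => exact ⟨trivial, by simp [pathDefs, pathProds]⟩
  case forget => exact ⟨by intro x; simp; tauto, subset_rfl⟩

theorem fromStart_mk (t : pathLang.Term ℕ) :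
    @Atom.mk pathLang 1 PathRel.fromStart (fun _ => t) = fromStart t := by
  simp only [fromStart, Atom.mk.injEq, heq_eq_eq, true_and]
  funext i; fin_cases i; rfl

theorem cyclicRule_prems {ν : List ℕ} {r : Rule pathLang} (h : cyclicRule ν = some r) (n : ℕ) :
    (cyclicTree (ν ++ [n])).map Prod.fst = (r.prems pathDefs)[n]? := by
  cases cyclicNode_of_cyclicRule h <;> obtain rfl := Option.some.inj h <;>
    rcases n with _ | _ | n <;>
    simp [cyclicTree, cyclicRule, Rule.prems, Rule.concl, pathDefs, pathProds, substSet,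
      cycleSequent, caseDistinction, Fml.subst, subst₂]
  case root.zero => rw [fromStart_mk]
  case generalize.zero => rw [Finset.pair_comm]; rfl
  case case.zero => rw [Finset.pair_comm]
  case case.succ.zero => rw [Finset.insert_comm]
  case stepCut.zero => rw [fromStart_mk]

theorem finite_cyclicTree : {ν | cyclicTree ν ≠ none}.Finite := by
  refine (Set.toFinite {[1, 0, 1, 0, 1, 0, 0], [], [0], [1], [1, 0], [1, 0, 0], [1, 0, 0, 0],
    [1, 0, 1], [1, 0, 1, 0], [1, 0, 1, 0, 0], [1, 0, 1, 0, 0, 0], [1, 0, 1, 0, 1],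
    [1, 0, 1, 0, 1, 0]}).subset ?_
  intro ν hν
  rcases cyclicNode_of_cyclicTree hν with rfl | h
  · exact Or.inl rfl
  · cases h <;> simp

theorem cyclicTree_of_node {ν : List ℕ} (h : CyclicNode ν) :
    ∃ r, cyclicRule ν = some r ∧ cyclicTree ν = some (r.concl, some r) := by
  cases h <;> exact ⟨_, rfl, by simp [cyclicTree, cyclicRule]⟩

theorem cyclicTree_bud : cyclicTree [1, 0, 1, 0, 1, 0, 0] = some (cycleSequent, none) := by
  simp [cyclicTree]

theorem cyclicTree_isDerivation : cyclicTree.IsDerivation pathDefs where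
  root := by
    obtain ⟨r, -, h⟩ := cyclicTree_of_node .root
    simp [h]
  prefix_closed ν n h := by
    by_contra h'
    have hν : ¬ CyclicNode ν := fun hν => by
      obtain ⟨r, -, h''⟩ := cyclicTree_of_node hν
      simp [h''] at h
    generalize hμ : ν ++ [n] = μ at h'
    rcases cyclicNode_of_cyclicTree h' with rfl | hm
    · obtain ⟨rfl, -⟩ := List.append_inj' (s₂ := [1, 0, 1, 0, 1, 0]) (t₂ := [0]) hμ rfl
      exact hν .back
    · cases hm
      case root => simp at hμ
      case start =>
        obtain ⟨rfl, -⟩ := List.append_inj' (s₂ := []) (t₂ := [0]) hμ rfl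
        exact hν .root
      case generalize =>
        obtain ⟨rfl, -⟩ := List.append_inj' (s₂ := []) (t₂ := [1]) hμ rfl
        exact hν .root
      case case =>
        obtain ⟨rfl, -⟩ := List.append_inj' (s₂ := [1]) (t₂ := [0]) hμ rfl
        exact hν .generalize
      case goal =>
        obtain ⟨rfl, -⟩ := List.append_inj' (s₂ := [1, 0]) (t₂ := [0]) hμ rfl
        exact hν .case
      case goalAx =>
        obtain ⟨rfl, -⟩ := List.append_inj' (s₂ := [1, 0, 0]) (t₂ := [0]) hμ rfl
        exact hν .goal
      case step =>
        obtain ⟨rfl, -⟩ := List.append_inj' (s₂ := [1, 0]) (t₂ := [1]) hμ rfl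
        exact hν .case
      case stepCut =>
        obtain ⟨rfl, -⟩ := List.append_inj' (s₂ := [1, 0, 1]) (t₂ := [0]) hμ rfl
        exact hν .step
      case unfold =>
        obtain ⟨rfl, -⟩ := List.append_inj' (s₂ := [1, 0, 1, 0]) (t₂ := [0]) hμ rfl
        exact hν .stepCut
      case unfoldAx =>
        obtain ⟨rfl, -⟩ := List.append_inj' (s₂ := [1, 0, 1, 0, 0]) (t₂ := [0]) hμ rfl
        exact hν .unfold
      case forget =>
        obtain ⟨rfl, -⟩ := List.append_inj' (s₂ := [1, 0, 1, 0]) (t₂ := [1]) hμ rfl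
        exact hν .stepCut
      case back =>
        obtain ⟨rfl, -⟩ := List.append_inj' (s₂ := [1, 0, 1, 0, 1]) (t₂ := [0]) hμ rfl
        exact hν .forget
  bud ν S n h := by
    rcases cyclicTree_eq_some h with ⟨rfl, -⟩ | ⟨r, -, -, -, h⟩
    · simp [cyclicTree, cyclicRule]
    · cases h
  rule ν S r h := by
    rcases cyclicTree_eq_some h with ⟨-, -, hl⟩ | ⟨r', -, hr, rfl, hl⟩
    · cases hl
    · obtain rfl := Option.some.inj hl
      exact ⟨cyclicRule_sideCondition hr, rfl, cyclicRule_prems hr⟩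

/-- The cyclic proof of `ToE(s) ⊢ FromS(e)`. -/
noncomputable def cyclicProof : PreProof pathDefs where
  tree := cyclicTree
  isDerivation := cyclicTree_isDerivation
  finite := finite_cyclicTree
  companion _ := [1, 0]
  companion_spec ν S h := by
    rcases cyclicTree_eq_some h with ⟨-, rfl, -⟩ | ⟨r, -, -, -, h⟩
    · obtain ⟨r, hr, h⟩ := cyclicTree_of_node .case
      refine ⟨r, h.trans ?_⟩
      obtain rfl := Option.some.inj hr
      simp only [Rule.concl, cycleSequent]
      rw [Finset.pair_comm]
      rfl
    · cases h

/-! ### Infinite paths and the trace around the cycle -/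

theorem resolve_cyclicProof (ν : List ℕ) :
    cyclicProof.resolve ν = if ν = [1, 0, 1, 0, 1, 0, 0] then [1, 0] else ν := by
  have h : cyclicProof.tree.IsBud ν ↔ ν = [1, 0, 1, 0, 1, 0, 0] := by
    constructor
    · rintro ⟨S, h⟩
      rcases cyclicTree_eq_some h with ⟨h, -⟩ | ⟨r, -, -, -, h⟩
      · exact h
      · cases h
    · rintro rfl
      exact ⟨_, cyclicTree_bud⟩
  simp only [PreProof.resolve, h]
  rfl

theorem cyclicNode_resolve {ν : List ℕ} (h : cyclicTree (cyclicProof.resolve ν) ≠ none) :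
    (ν = [1, 0, 1, 0, 1, 0, 0] ∧ cyclicProof.resolve ν = [1, 0]) ∨
      (CyclicNode ν ∧ cyclicProof.resolve ν = ν) := by
  rw [resolve_cyclicProof] at h ⊢
  split_ifs at h ⊢ with hν
  · exact Or.inl ⟨hν, rfl⟩
  · exact Or.inr ⟨(cyclicNode_of_cyclicTree h).resolve_left hν, rfl⟩

/-- `CyclicEdge ν n μ`: the node `μ` is the `n`-th child of `ν`, or the companion of this child. -/
inductive CyclicEdge : List ℕ → ℕ → List ℕ → Prop
  | start : CyclicEdge [] 0 [0]
  | generalize : CyclicEdge [] 1 [1]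
  | case : CyclicEdge [1] 0 [1, 0]
  | goal : CyclicEdge [1, 0] 0 [1, 0, 0]
  | goalAx : CyclicEdge [1, 0, 0] 0 [1, 0, 0, 0]
  | step : CyclicEdge [1, 0] 1 [1, 0, 1]
  | stepCut : CyclicEdge [1, 0, 1] 0 [1, 0, 1, 0]
  | unfold : CyclicEdge [1, 0, 1, 0] 0 [1, 0, 1, 0, 0]
  | unfoldAx : CyclicEdge [1, 0, 1, 0, 0] 0 [1, 0, 1, 0, 0, 0]
  | forget : CyclicEdge [1, 0, 1, 0] 1 [1, 0, 1, 0, 1]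
  | back : CyclicEdge [1, 0, 1, 0, 1] 0 [1, 0, 1, 0, 1, 0]
  | loop : CyclicEdge [1, 0, 1, 0, 1, 0] 0 [1, 0]

/-- The edges of the cycle. -/
inductive LoopEdge : List ℕ → ℕ → List ℕ → Prop
  | step : LoopEdge [1, 0] 1 [1, 0, 1]
  | stepCut : LoopEdge [1, 0, 1] 0 [1, 0, 1, 0]
  | forget : LoopEdge [1, 0, 1, 0] 1 [1, 0, 1, 0, 1]
  | back : LoopEdge [1, 0, 1, 0, 1] 0 [1, 0, 1, 0, 1, 0]
  | loop : LoopEdge [1, 0, 1, 0, 1, 0] 0 [1, 0]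

theorem cyclicEdge_of_child {ν : List ℕ} {n : ℕ} (hν : CyclicNode ν)
    (h : cyclicTree (cyclicProof.resolve (ν ++ [n])) ≠ none) :
    CyclicEdge ν n (cyclicProof.resolve (ν ++ [n])) := by
  rcases cyclicNode_resolve h with ⟨h1, h2⟩ | ⟨h1, h2⟩
  · rw [h2]
    obtain ⟨rfl, hn⟩ := List.append_inj' (s₂ := [1, 0, 1, 0, 1, 0]) (t₂ := [0]) h1 rfl
    obtain rfl : n = 0 := by simpa using hn
    exact .loop
  · rw [h2]
    cases hν <;> cases h1 <;> constructor

/-- Two preceding edges rule out the initial segment above the root; two following edges rule out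
the branches that end in axioms. -/
theorem loopEdge_of_chain {a b c d e f : List ℕ} {i j k l m : ℕ} (h1 : CyclicEdge a i b)
    (h2 : CyclicEdge b j c) (h3 : CyclicEdge c k d) (h4 : CyclicEdge d l e)
    (h5 : CyclicEdge e m f) : LoopEdge c k d := by
  cases h3 <;> first | constructor | skip
  all_goals cases h4 <;> try cases h5
  all_goals cases h2 <;> cases h1

/-- The cycle has length five, so five consecutive nodes meet the case split. -/
theorem exists_eq_case_of_loopEdge {q : ℕ → List ℕ} {m : ℕ → ℕ}
    (h : ∀ i, LoopEdge (q i) (m i) (q (i + 1))) (i : ℕ) : ∃ j, i ≤ j ∧ q j = [1, 0] := by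
  have h0 := h i
  have h1 := h (i + 1)
  have h2 := h (i + 2)
  have h3 := h (i + 3)
  have h4 := h (i + 4)
  by_contra! hne
  have n0 := hne i le_rfl
  have n1 := hne (i + 1) (by omega)
  have n2 := hne (i + 2) (by omega)
  have n3 := hne (i + 3) (by omega)
  have n4 := hne (i + 4) (by omega)
  simp only [add_assoc, Nat.reduceAdd] at h0 h1 h2 h3 h4
  generalize m i = b0 at *
  generalize m (i + 1) = b1 at *
  generalize m (i + 2) = b2 at *
  generalize m (i + 3) = b3 at *
  generalize m (i + 4) = b4 at *
  generalize q (i + 5) = a5 at *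
  generalize q i = a0 at *
  generalize q (i + 1) = a1 at *
  generalize q (i + 2) = a2 at *
  generalize q (i + 3) = a3 at *
  generalize q (i + 4) = a4 at *
  cases h0 <;> first | contradiction | skip
  all_goals (cases h1; try contradiction)
  all_goals (cases h2; try contradiction)
  all_goals (cases h3; contradiction)

/-- The trace through the cycle. -/
noncomputable def loopTrace (ν : List ℕ) : Atom pathLang :=
  if ν = [1, 0] then toGoal (varTerm 0) else toGoal (nextTerm (varTerm 1))

theorem caseDescendant_loop {r : Rule pathLang} (h : cyclicRule [1, 0] = some r) :
    r.CaseDescendant pathDefs 1 (toGoal (varTerm 0)) (toGoal (nextTerm (varTerm 1))) := by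
  obtain rfl := Option.some.inj h
  refine ⟨rfl, _, rfl, toGoal (nextTerm (varTerm 0)), by simp, trivial, ?_⟩
  simp [Term.subst]

/-- The case split turns ToE(x) into ToE(n y), which is carried unchanged until the substitution x
:= n y identifies it with ToE(x) again. -/
theorem LoopEdge.traceStep {ν μ : List ℕ} {n : ℕ} (h : LoopEdge ν n μ) {r : Rule pathLang}
    (hr : cyclicRule ν = some r) :
    Fml.atom (loopTrace ν) ∈ r.concl.ant ∧
      r.TraceStep pathDefs n (loopTrace ν) (loopTrace μ) := by
  cases h
  case step =>
    have hd := caseDescendant_loop hr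
    obtain rfl := Option.some.inj hr
    exact ⟨by simp [Rule.concl, loopTrace, toGoal], Or.inl hd⟩
  case stepCut =>
    obtain rfl := Option.some.inj hr
    refine ⟨?_, toGoal (nextTerm (varTerm 1)), 2, 3, by decide, ?_, ?_⟩ <;>
      simp [Rule.concl, loopTrace, substSet, Fml.subst, subst₂, Term.subst]
  case forget | back =>
    obtain rfl := Option.some.inj hr
    exact ⟨by simp [Rule.concl, loopTrace], rfl⟩
  case loop =>
    obtain rfl := Option.some.inj hr
    refine ⟨by simp [Rule.concl, loopTrace, substSet, Fml.subst, Term.subst], ?_⟩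
    simp [Rule.TraceStep, loopTrace, Term.subst]

theorem isProof_cyclicProof : cyclicProof.IsProof := by
  rintro p ⟨hp, hs⟩
  choose m hm using hs
  set q : ℕ → List ℕ := fun i => cyclicProof.follow [] (p i) with hq
  -- Nodes visited by the unfolding are resolved, hence inner nodes.
  have hres : ∀ σ, ∃ ν, cyclicProof.follow [] σ = cyclicProof.resolve ν := by
    intro σ
    induction σ using List.reverseRecOn with
    | nil => exact ⟨[], rfl⟩
    | append_singleton σ n _ => exact ⟨_, cyclicProof.follow_append σ n⟩
  have hnode : ∀ i, CyclicNode (q i) := by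
    intro i
    obtain ⟨ν, hν⟩ := hres (p i)
    have h : cyclicTree (cyclicProof.follow [] (p i)) ≠ none := hp i
    change CyclicNode (cyclicProof.follow [] (p i))
    rw [hν] at h ⊢
    rcases cyclicNode_resolve h with ⟨-, h⟩ | ⟨h1, h⟩
    · rw [h]; exact .case
    · rw [h]; exact h1
  have hsucc : ∀ i, q (i + 1) = cyclicProof.resolve (q i ++ [m i]) := fun i => by
    simp only [hq, hm, PreProof.follow_append]
  have hedge : ∀ i, CyclicEdge (q i) (m i) (q (i + 1)) := by
    intro i
    rw [hsucc]
    refine cyclicEdge_of_child (hnode i) ?_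
    rw [← hsucc]
    exact hp (i + 1)
  have hloop : ∀ i, LoopEdge (q (2 + i)) (m (2 + i)) (q (2 + (i + 1))) := by
    intro i
    rw [add_comm 2 i, show 2 + (i + 1) = i + 2 + 1 by omega]
    exact loopEdge_of_chain (hedge i) (hedge (i + 1)) (hedge (i + 2)) (hedge (i + 3))
      (hedge (i + 4))
  have htree : ∀ i, ∃ r, cyclicRule (q i) = some r ∧
      cyclicProof.unfolding (p i) = some (r.concl, some r) := fun i => cyclicTree_of_node (hnode i)
  -- Two steps lead from the root through the cut and the generalization into the cycle.
  refine ⟨2, fun i => loopTrace (q (2 + i)), ⟨fun i => ⟨trivial, fun S l h => ?_⟩,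
    fun i S r n h hn => ?_⟩, ?_⟩
  · obtain ⟨r, hr, ht⟩ := htree (2 + i)
    simp only [ht, Option.some.injEq, Prod.mk.injEq] at h
    rw [← h.1]
    exact ((hloop i).traceStep hr).1
  · obtain ⟨r', hr, ht⟩ := htree (2 + i)
    simp only [ht, Option.some.injEq, Prod.mk.injEq] at h
    obtain ⟨-, rfl⟩ := h
    have h1 : p (2 + (i + 1)) = p (2 + i) ++ [m (2 + i)] := hm (2 + i)
    change p (2 + (i + 1)) = p (2 + i) ++ [n] at hn
    rw [h1] at hn
    obtain rfl : m (2 + i) = n := by simpa using hn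
    exact ((hloop i).traceStep hr).2
  · refine Set.infinite_of_not_bddAbove fun ⟨N, hN⟩ => ?_
    obtain ⟨j, hj, hqj⟩ := exists_eq_case_of_loopEdge (q := fun i => q (2 + i)) hloop (N + 1)
    refine absurd (hN (a := j) ?_) (by omega)
    obtain ⟨r, hr, ht⟩ := htree (2 + j)
    have hl := hloop j
    change q (2 + j) = [1, 0] at hqj
    have hm' : m (2 + j) = 1 ∧ q (2 + (j + 1)) = [1, 0, 1] := by
      rw [hqj] at hl
      generalize m (2 + j) = a at hl
      generalize q (2 + (j + 1)) = b at hl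
      cases hl
      exact ⟨rfl, rfl⟩
    refine ⟨_, r, 1, ht, ?_, ?_⟩
    · have h1 := hm (2 + j)
      rw [hm'.1] at h1
      exact h1
    · rw [hqj] at hr
      simpa [loopTrace, hqj, hm'.2] using caseDescendant_loop hr

theorem provable_pathSequent : Provable pathDefs pathSequent := by
  refine ⟨cyclicProof, ?_, isProof_cyclicProof⟩
  obtain ⟨r, hr, h⟩ := cyclicTree_of_node .root
  obtain rfl := Option.some.inj hr
  exact ⟨_, h⟩

end CLKID

theorem corollary2 :
    (¬ ∀ (L : FirstOrder.Language.{0, 0}) (Φ : CLKID.IndDefSet L),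
      CLKID.UnaryPredicates L → CLKID.ConstantsAndOneUnary L → CLKID.CutElimination Φ) ∧
    CLKID.Provable CLKID.pathDefs CLKID.pathSequent ∧
    ¬ CLKID.CutFreeProvable CLKID.pathDefs CLKID.pathSequent := by
  refine ⟨fun h => CLKID.not_cutFreeProvable_pathSequent
    (h CLKID.pathLang CLKID.pathDefs ?_ ?_ _ CLKID.provable_pathSequent),
    CLKID.provable_pathSequent, CLKID.not_cutFreeProvable_pathSequent⟩
  · rintro n ⟨R⟩
    cases R <;> rfl
  · refine ⟨?_, ⟨⟨⟨.next⟩, ?_⟩⟩⟩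
    · rintro n ⟨f⟩
      cases f <;> decide
    · intro f
      cases f
      rfl
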